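/- Let $\alpha\in(0,2]$. Let $L_\alpha$ denote a random variable with the Linnik distribution with parameter $\alpha$, i.e. with characteristic function $\mathsf E e^{itL_\alpha}=\frac{1}{1+|t|^{\alpha}}$, $t\in\mathbb R$, and let $M_{\alpha/2}$ denote a nonnegative random variable with the standard Mittag-Leffler distribution with parameter $\alpha/2$, i.e. with Laplace transform $\mathsf E e^{-sM_{\alpha/2}}=\frac{1}{1+s^{\alpha/2}}$, $s\ge 0$. Let the real random variables $X_1,X_2,\ldots$ and the positive-integer-valued random variables $N_1,N_2,\ldots$ be defined on one probability space $(\Omega,\mathcal A,\mathsf P)$, and suppose that for each $n\ge1$ the random variable $N_n$ is independent of the sequence $X_1,X_2,\ldots$. (The $X_i$ need be neither independent nor identically distributed.) Suppose that $N_n\to\infty$ in probability, i.e. $\mathsf P(N_n\le m)\to0$ as $n\to\infty$ for every $m\in(0,\infty)$. For each $n$ let $T_n=T_n(X_1,\ldots,X_n)$ be a statistic, i.e. a measurable function of $X_1,\ldots,X_n$, and define $T_{N_n}(\omega)=T_{N_n(\omega)}\bigl(X_1(\omega),\ldots,X_{N_n(\omega)}(\omega)\bigr)$. Suppose that $T_n$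 is asymptotically normal: with some constants $\delta>0$ and $\theta\in\mathbb R$, the random variables $\delta\sqrt n\,(T_n-\theta)$ converge in distribution to the standard normal law $N(0,1)$ as $n\to\infty$. Then $$\delta\sqrt n\,\bigl(T_{N_n}-\theta\bigr)\Longrightarrow L_\alpha\qquad(n\to\infty)$$ if and only if $$\frac{N_n}{n}\Longrightarrow \bigl(2M_{\alpha/2}\bigr)^{-1}\qquad(n\to\infty),$$ where $\Longrightarrow$ denotes convergence in distribution. -/

import Mathlib

open MeasureTheory ProbabilityTheory Filter Topology

/-- `ν` is the (standard) Mittag-Leffler distribution with parameter `δ`: the probability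
distribution of a nonnegative random variable with Laplace transform `1 / (1 + s ^ δ)`, `s ≥ 0`. -/
structure IsMittagLefflerLaw (δ : ℝ) (ν : Measure ℝ) [IsProbabilityMeasure ν] : Prop where
  ae_nonneg : ∀ᵐ x ∂ν, 0 ≤ x
  laplace_eq : ∀ s : ℝ, 0 ≤ s → ∫ x, Real.exp (-(s * x)) ∂ν = 1 / (1 + s ^ δ)

/-- `ν` is the Linnik distribution with parameter `α`: the probability distribution on the real
line with characteristic function `1 / (1 + |t| ^ α)`. -/
structure IsLinnikLaw (α : ℝ) (ν : Measure ℝ) [IsProbabilityMeasure ν] : Prop where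
  charFun_eq : ∀ t : ℝ, charFun ν t = ((1 / (1 + |t| ^ α) : ℝ) : ℂ)

section Samples

variable {Ω : Type*}

/-- The statistic `T_n = T_n(X_1, …, X_n)` evaluated on the first `n` observations.
The observation `X_{i+1}` of the sequence is `X i`. -/
def sampleStat (T : (n : ℕ) → (Fin n → ℝ) → ℝ) (X : ℕ → Ω → ℝ) (n : ℕ) (ω : Ω) : ℝ :=
  T n (fun i => X i ω)

/-- The statistic `T_N` constructed from a sample of random size `N`:
`T_N(ω) = T_{N(ω)}(X_1(ω), …, X_{N(ω)}(ω))`. -/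
def randomSizeStat (T : (n : ℕ) → (Fin n → ℝ) → ℝ) (X : ℕ → Ω → ℝ) (N : Ω → ℕ) (ω : Ω) : ℝ :=
  sampleStat T X (N ω) ω

/-- `N_n → ∞` in probability: `P(N_n ≤ m) → 0` for every `m ∈ (0, ∞)`. -/
def TendstoInftyInProbability [MeasurableSpace Ω] (P : Measure Ω) (N : ℕ → Ω → ℕ) : Prop :=
  ∀ m : ℝ, 0 < m → Tendsto (fun n => P {ω | (N n ω : ℝ) ≤ m}) atTop (𝓝 0)

/-- Asymptotic normality of `T_n(X_1, …, X_n)` with constants `δ` and `θ`: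
`δ √n (T_n - θ)` converges in distribution to the standard normal law. -/
def AsymptoticallyNormal [MeasurableSpace Ω] (P : Measure Ω) [IsProbabilityMeasure P]
    (T : (n : ℕ) → (Fin n → ℝ) → ℝ) (X : ℕ → Ω → ℝ) (δ θ : ℝ) : Prop :=
  TendstoInDistribution
    (fun (n : ℕ) (ω : Ω) => δ * √(n : ℝ) * (sampleStat T X n ω - θ)) atTop
    (fun x : ℝ => x) (fun _ => P) (gaussianReal 0 1)

end Samples

/-! Put `Z k = δ √k (T_k - θ)` and `U_n = n / N_n`; then `δ √n (T_{N_n} - θ) = √U_n * Z (N_n)`. By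
independence its characteristic function at `t` is the mean over `N_n` of the characteristic
function of `Z k` at `t √U_n`, with `k = N_n`. As `N_n → ∞` and characteristic functions converge
uniformly on compacts, tightness of `U_n` lets each one be replaced by `exp (-t² U_n / 2)`
(`tendsto_charFun_randomIndex_sub`). What remains is the Laplace transform of `U_n` at `t² / 2`; for
`2M` that transform equals `1 / (1 + |t|^α)`, the Linnik characteristic function.

So both sides of the equivalence say that the Laplace transforms of `U_n` converge to that of `2M`,
once `U_n` is tight. Given the limit of `N_n / n`, tightness follows because `M` has no atom at `0`.
Given the limit of the statistic, it follows because `|Z k| > 1` has probability bounded below for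
large `k`, so a large `U_n` would spoil the tightness of the product
(`exists_eventually_measure_div_ge_lt`). Convergence in law is recovered from Laplace transforms at
integers: these are the moments of `exp (-U_n)`, a variable in `[0, 1]`
(`tendstoInDistribution_of_tendsto_moments`). -/

/-! ### Weak convergence: continuous mapping, characteristic functions, moments. -/

section ConvergenceInDistribution

variable {Ω Ω' : Type*} [MeasurableSpace Ω] [MeasurableSpace Ω']
  {P : Measure Ω} [IsProbabilityMeasure P] {Q : Measure Ω'} [IsProbabilityMeasure Q]

/-- Weak convergence gives convergence of integrals of bounded continuous functions. -/
lemma MeasureTheory.TendstoInDistribution.tendsto_integral_comp {ι : Type*} {l : Filter ι} {Y : ι → Ω → ℝ}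
    {Z : Ω' → ℝ} (h : TendstoInDistribution Y l Z (fun _ => P) Q) {f : ℝ → ℝ}
    (hf : Continuous f) {C : ℝ} (hC : ∀ x, |f x| ≤ C) :
    Tendsto (fun i => ∫ ω, f (Y i ω) ∂P) l (𝓝 (∫ ω, f (Z ω) ∂Q)) := by
  have h1 := ProbabilityMeasure.tendsto_iff_forall_integral_tendsto.1 h.tendsto
    (BoundedContinuousFunction.ofNormedAddCommGroup f hf C hC)
  simp only [ProbabilityMeasure.coe_mk, BoundedContinuousFunction.coe_ofNormedAddCommGroup] at h1
  rw [integral_map h.aemeasurable_limit hf.aestronglyMeasurable] at h1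
  refine h1.congr fun i => ?_
  rw [integral_map (h.forall_aemeasurable i) hf.aestronglyMeasurable]

/-- Portmanteau bound for closed sets, in terms of random variables. -/
lemma MeasureTheory.TendstoInDistribution.eventually_measure_preimage_lt {ι : Type*} {l : Filter ι}
    {Y : ι → Ω → ℝ} {Z : Ω' → ℝ} (h : TendstoInDistribution Y l Z (fun _ => P) Q) {F : Set ℝ}
    (hF : IsClosed F) {c : ENNReal} (hc : Q (Z ⁻¹' F) < c) :
    ∀ᶠ i in l, P (Y i ⁻¹' F) < c := by
  have h1 := ProbabilityMeasure.limsup_measure_closed_le_of_tendsto h.tendsto hF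
  simp only [ProbabilityMeasure.coe_mk] at h1
  rw [Measure.map_apply_of_aemeasurable h.aemeasurable_limit hF.measurableSet] at h1
  filter_upwards [eventually_lt_of_limsup_lt (h1.trans_lt hc)] with i hi
  rwa [Measure.map_apply_of_aemeasurable (h.forall_aemeasurable i) hF.measurableSet] at hi

/-- Portmanteau bound for open sets, in terms of random variables. -/
lemma MeasureTheory.TendstoInDistribution.eventually_lt_measure_preimage {ι : Type*} {l : Filter ι}
    {Y : ι → Ω → ℝ} {Z : Ω' → ℝ} (h : TendstoInDistribution Y l Z (fun _ => P) Q) {G : Set ℝ}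
    (hG : IsOpen G) {c : ENNReal} (hc : c < Q (Z ⁻¹' G)) :
    ∀ᶠ i in l, c < P (Y i ⁻¹' G) := by
  have h1 := ProbabilityMeasure.le_liminf_measure_open_of_tendsto h.tendsto hG
  simp only [ProbabilityMeasure.coe_mk] at h1
  rw [Measure.map_apply_of_aemeasurable h.aemeasurable_limit hG.measurableSet] at h1
  filter_upwards [eventually_lt_of_lt_liminf (hc.trans_le h1)] with i hi
  rwa [Measure.map_apply_of_aemeasurable (h.forall_aemeasurable i) hG.measurableSet] at hi

/-- **Continuous mapping theorem** for a map that is continuous almost everywhere with respect to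
the limit law. -/
lemma MeasureTheory.TendstoInDistribution.comp_of_ae_continuousAt {Y : ℕ → Ω → ℝ} {Z : Ω' → ℝ}
    (h : TendstoInDistribution Y atTop Z (fun _ => P) Q) {g : ℝ → ℝ} (hg : Measurable g)
    (hcont : ∀ᵐ ω ∂Q, ContinuousAt g (Z ω)) :
    TendstoInDistribution (fun n ω => g (Y n ω)) atTop (fun ω => g (Z ω)) (fun _ => P) Q where
  forall_aemeasurable n := hg.comp_aemeasurable (h.forall_aemeasurable n)
  aemeasurable_limit := hg.comp_aemeasurable h.aemeasurable_limit
  tendsto := by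
    refine tendsto_of_forall_isClosed_limsup_le' fun F hF => ?_
    simp only [ProbabilityMeasure.coe_mk]
    rw [Measure.map_apply_of_aemeasurable (f := fun ω => g (Z ω))
      (hg.comp_aemeasurable h.aemeasurable_limit) hF.measurableSet]
    refine le_of_forall_gt fun c hc => ?_
    -- At a continuity point of `g`, lying in the closure of `g ⁻¹' F` already forces the value of
    -- `g` into `F`; so taking the closure costs no mass.
    have hsub : Q (Z ⁻¹' closure (g ⁻¹' F)) ≤ Q ((fun ω => g (Z ω)) ⁻¹' F) := by
      refine measure_mono_ae ?_
      filter_upwards [hcont] with ω hω hmem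
      have := mem_closure_image hω (Set.mem_preimage.1 hmem)
      exact closure_minimal (Set.image_preimage_subset g F) hF this
    obtain ⟨d, hd1, hd2⟩ := exists_between hc
    have := h.eventually_measure_preimage_lt isClosed_closure (hsub.trans_lt hd1)
    refine lt_of_le_of_lt (limsup_le_of_le (by isBoundedDefault) ?_) hd2
    filter_upwards [this] with n hn
    rw [Measure.map_apply_of_aemeasurable (f := fun ω => g (Y n ω))
      (hg.comp_aemeasurable (h.forall_aemeasurable n)) hF.measurableSet]
    exact (measure_mono (Set.preimage_mono (f := Y n) subset_closure)).trans hn.le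

/-- A sequence that converges in distribution is bounded above in probability. -/
lemma MeasureTheory.TendstoInDistribution.exists_eventually_measure_ge_lt {Y : ℕ → Ω → ℝ} {Z : Ω' → ℝ}
    (h : TendstoInDistribution Y atTop Z (fun _ => P) Q) {ε : ENNReal} (hε : 0 < ε) :
    ∃ K : ℝ, 0 < K ∧ ∀ᶠ n in atTop, P {ω | K ≤ Y n ω} < ε := by
  have h1 : Tendsto (fun k : ℕ => Q (Z ⁻¹' Set.Ici (k : ℝ))) atTop (𝓝 0) := by
    have h2 := tendsto_measure_iInter_atTop (μ := Q) (s := fun k : ℕ => Z ⁻¹' Set.Ici (k : ℝ))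
      (fun k => h.aemeasurable_limit.nullMeasurableSet_preimage measurableSet_Ici)
      (fun i j hij => Set.preimage_mono (Set.Ici_subset_Ici.2 (by exact_mod_cast hij)))
      ⟨0, measure_ne_top _ _⟩
    have h3 : (⋂ k : ℕ, Z ⁻¹' Set.Ici (k : ℝ)) = ∅ := by
      ext ω
      simp only [Set.mem_iInter, Set.mem_preimage, Set.mem_Ici, Set.mem_empty_iff_false, iff_false,
        not_forall, not_le]
      exact exists_nat_gt (Z ω)
    rw [h3, measure_empty] at h2
    exact h2
  obtain ⟨k, hk1, hk2⟩ := ((h1.eventually_lt_const hε).and (eventually_gt_atTop 0)).exists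
  exact ⟨k, by exact_mod_cast hk2, h.eventually_measure_preimage_lt isClosed_Ici hk1⟩

/-- Moves the argument `s` into the random variable, so that one fixed bounded test function serves
for all arguments. -/
lemma integral_exp_mul_I_map_mul {μ : Measure Ω} {W : Ω → ℝ} (hW : AEMeasurable W μ) (s : ℝ) :
    ∫ x : ℝ, Complex.exp (x * Complex.I) ∂(μ.map (fun ω => s * W ω)) = charFun (μ.map W) s := by
  have h : charFun ((μ.map W).map (fun x => s * x)) 1 = charFun (μ.map W) s := by
    rw [charFun_map_mul, mul_one]
  rw [← h, AEMeasurable.map_map_of_aemeasurable (by fun_prop) hW, charFun_apply_real]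
  simp [Function.comp_def]

/-- Characteristic functions of a sequence converging in distribution converge jointly in the
index and the argument. -/
lemma MeasureTheory.TendstoInDistribution.tendsto_charFun_prod {Z : ℕ → Ω → ℝ} {Y : Ω' → ℝ}
    (h : TendstoInDistribution Z atTop Y (fun _ => P) Q) (t : ℝ) :
    Tendsto (fun p : ℕ × ℝ => charFun (P.map (Z p.1)) p.2) (atTop ×ˢ 𝓝 t)
      (𝓝 (charFun (Q.map Y) t)) := by
  have h1 : TendstoInDistribution (fun p : ℕ × ℝ => Z p.1) (atTop ×ˢ 𝓝 t) Y (fun _ => P) Q :=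
    ⟨fun p => h.forall_aemeasurable p.1, h.aemeasurable_limit, h.tendsto.comp tendsto_fst⟩
  -- Slutsky: the argument is regarded as a constant random variable tending to `t` in probability,
  -- and is then multiplied into `Z`.
  have h2 : TendstoInMeasure P (fun (p : ℕ × ℝ) (_ : Ω) => p.2) (atTop ×ˢ 𝓝 t) (fun _ => t) := by
    intro ε hε
    refine tendsto_const_nhds.congr' ?_
    have : ∀ᶠ p : ℕ × ℝ in atTop ×ˢ 𝓝 t, edist p.2 t < ε :=
      tendsto_snd.eventually (Metric.eball_mem_nhds t hε)
    filter_upwards [this] with p hp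
    simp [not_le.2 hp]
  have h3 := TendstoInDistribution.continuous_comp_prodMk_of_tendstoInMeasure_const
    (g := fun x : ℝ × ℝ => x.2 * x.1) (by fun_prop) h1 h2 (fun _ => aemeasurable_const)
  have h5 := ((ProbabilityMeasure.tendsto_iff_forall_integral_rclike_tendsto ℂ).1 h3.tendsto)
    (BoundedContinuousFunction.ofNormedAddCommGroup (fun x : ℝ => Complex.exp (x * Complex.I))
      (by fun_prop) 1 (fun x => by rw [Complex.norm_exp_ofReal_mul_I]))
  simp only [ProbabilityMeasure.coe_mk, BoundedContinuousFunction.coe_ofNormedAddCommGroup] at h5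
  rw [integral_exp_mul_I_map_mul h.aemeasurable_limit] at h5
  refine h5.congr fun p => ?_
  rw [integral_exp_mul_I_map_mul (h.forall_aemeasurable p.1)]

/-- Characteristic functions of a sequence converging in distribution converge uniformly on
compact sets. -/
lemma MeasureTheory.TendstoInDistribution.tendstoUniformlyOn_charFun {Z : ℕ → Ω → ℝ} {Y : Ω' → ℝ}
    (h : TendstoInDistribution Z atTop Y (fun _ => P) Q) {K : Set ℝ} (hK : IsCompact K) :
    TendstoUniformlyOn (fun k s => charFun (P.map (Z k)) s) (charFun (Q.map Y)) atTop K := by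
  refine (tendstoLocallyUniformlyOn_iff_tendstoUniformlyOn_of_compact hK).1 ?_
  refine TendstoLocallyUniformly.tendstoLocallyUniformlyOn ?_
  rw [tendstoLocallyUniformly_iff_forall_tendsto]
  intro t
  have hY := Measure.isProbabilityMeasure_map h.aemeasurable_limit
  have h1 : Tendsto (fun p : ℕ × ℝ => charFun (Q.map Y) p.2) (atTop ×ˢ 𝓝 t)
      (𝓝 (charFun (Q.map Y) t)) := (continuous_charFun.tendsto t).comp tendsto_snd
  exact (h1.prodMk_nhds (h.tendsto_charFun_prod t)).mono_right (nhds_le_uniformity _)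

lemma integrable_pow_of_mem_Icc {W : Ω → ℝ} (hWm : AEMeasurable W P)
    (hW : ∀ᵐ ω ∂P, W ω ∈ Set.Icc (0 : ℝ) 1) (j : ℕ) :
    Integrable (fun ω => W ω ^ j) P := by
  refine Integrable.of_bound (hWm.pow_const j).aestronglyMeasurable 1 ?_
  filter_upwards [hW] with ω hω
  rw [Real.norm_of_nonneg (pow_nonneg hω.1 j)]
  exact pow_le_one₀ hω.1 hω.2

lemma integral_polynomial_eval_of_mem_Icc {W : Ω → ℝ} (hWm : AEMeasurable W P)
    (hW : ∀ᵐ ω ∂P, W ω ∈ Set.Icc (0 : ℝ) 1) (p : Polynomial ℝ) :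
    ∫ ω, p.eval (W ω) ∂P =
      ∑ j ∈ Finset.range (p.natDegree + 1), p.coeff j * ∫ ω, W ω ^ j ∂P := by
  simp_rw [Polynomial.eval_eq_sum_range]
  rw [integral_finsetSum _ fun j _ => (integrable_pow_of_mem_Icc hWm hW j).const_mul _]
  simp_rw [integral_const_mul]

lemma abs_integral_polynomial_sub_le_of_mem_Icc {W : Ω → ℝ} (hWm : AEMeasurable W P)
    (hW : ∀ᵐ ω ∂P, W ω ∈ Set.Icc (0 : ℝ) 1) {p : Polynomial ℝ}
    {f : BoundedContinuousFunction ℝ ℝ} {ε : ℝ}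
    (hp : ∀ x ∈ Set.Icc (0 : ℝ) 1, |p.eval x - f x| < ε) :
    |∫ ω, p.eval (W ω) ∂P - ∫ ω, f (W ω) ∂P| ≤ ε := by
  have hfi : Integrable (fun ω => f (W ω)) P :=
    Integrable.of_bound (f.continuous.measurable.comp_aemeasurable hWm).aestronglyMeasurable
      ‖f‖ (ae_of_all _ fun ω => f.norm_coe_le_norm _)
  have hpi : Integrable (fun ω => p.eval (W ω)) P := by
    simp_rw [Polynomial.eval_eq_sum_range]
    exact integrable_finsetSum _ fun j _ => (integrable_pow_of_mem_Icc hWm hW j).const_mul _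
  rw [← integral_sub hpi hfi]
  have := norm_integral_le_of_norm_le_const (μ := P) (C := ε)
    (f := fun ω => p.eval (W ω) - f (W ω))
    (by filter_upwards [hW] with ω hω using (hp _ hω).le)
  simpa using this

/-- Random variables with values in `[0, 1]` converge in distribution as soon as all their moments
converge. -/
lemma tendstoInDistribution_of_tendsto_moments {Y : ℕ → Ω → ℝ} {Z : Ω' → ℝ}
    (hYm : ∀ n, Measurable (Y n)) (hZm : AEMeasurable Z Q)
    (hY : ∀ n ω, Y n ω ∈ Set.Icc (0 : ℝ) 1) (hZ : ∀ᵐ ω ∂Q, Z ω ∈ Set.Icc (0 : ℝ) 1)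
    (h : ∀ j : ℕ, Tendsto (fun n => ∫ ω, Y n ω ^ j ∂P) atTop (𝓝 (∫ ω, Z ω ^ j ∂Q))) :
    TendstoInDistribution Y atTop Z (fun _ => P) Q where
  forall_aemeasurable n := (hYm n).aemeasurable
  aemeasurable_limit := hZm
  tendsto := by
    refine ProbabilityMeasure.tendsto_iff_forall_integral_tendsto.2 fun f => ?_
    change Tendsto (fun n => ∫ x, f x ∂(P.map (Y n))) atTop (𝓝 (∫ x, f x ∂(Q.map Z)))
    rw [integral_map hZm f.continuous.aestronglyMeasurable]
    refine Tendsto.congr (fun n => (integral_map (hYm n).aemeasurable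
      f.continuous.aestronglyMeasurable).symm) ?_
    rw [Metric.tendsto_atTop']
    intro ε hε
    -- Weierstrass: moments control polynomials, which approximate `f` uniformly on `[0, 1]`.
    obtain ⟨p, hp⟩ := exists_polynomial_near_of_continuousOn 0 1 f f.continuous.continuousOn
      (ε / 3) (by positivity)
    have h1 : Tendsto (fun n => ∫ ω, p.eval (Y n ω) ∂P) atTop (𝓝 (∫ ω, p.eval (Z ω) ∂Q)) := by
      rw [integral_polynomial_eval_of_mem_Icc hZm hZ]
      refine Tendsto.congr (fun n => (integral_polynomial_eval_of_mem_Icc (P := P)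
        (hYm n).aemeasurable (ae_of_all _ (hY n)) p).symm) ?_
      exact tendsto_finsetSum _ fun j _ => (h j).const_mul _
    rw [Metric.tendsto_atTop'] at h1
    obtain ⟨n₀, hn₀⟩ := h1 (ε / 3) (by positivity)
    refine ⟨n₀, fun n hn => ?_⟩
    have h2 := hn₀ n hn
    have h3 := abs_integral_polynomial_sub_le_of_mem_Icc (P := P) (hYm n).aemeasurable
      (ae_of_all _ (hY n)) hp
    have h4 := abs_integral_polynomial_sub_le_of_mem_Icc hZm hZ hp
    rw [Real.dist_eq] at h2 ⊢
    rw [abs_lt] at h2 ⊢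
    rw [abs_le] at h3 h4
    constructor <;> linarith [h2.1, h2.2, h3.1, h3.2, h4.1, h4.2]

end ConvergenceInDistribution

/-! ### Sequences evaluated at an independent random index. -/

section RandomIndex

variable {Ω : Type*} [MeasurableSpace Ω] {P : Measure Ω} [IsProbabilityMeasure P]

lemma measurable_randomIndex {N : Ω → ℕ} {Z : ℕ → Ω → ℝ} (hN : Measurable N)
    (hZ : ∀ k, Measurable (Z k)) : Measurable (fun ω => Z (N ω) ω) := by
  have h : Measurable (fun p : ℕ × Ω => Z p.1 p.2) := measurable_from_prod_countable_right hZ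
  exact h.comp (hN.prodMk measurable_id)

/-- An expectation of a sequence taken at an independent random index is computed by first
integrating out the sequence. -/
lemma integral_randomIndex_of_indepFun {E : Type*} [NormedAddCommGroup E] [NormedSpace ℝ E]
    [MeasurableSpace E] [BorelSpace E] [SecondCountableTopology E] {N : Ω → ℕ} {Z : ℕ → Ω → ℝ}
    (hN : Measurable N) (hZ : ∀ k, Measurable (Z k))
    (hind : IndepFun N (fun ω k => Z k ω) P) {g : ℕ → ℝ → E} (hg : ∀ k, Measurable (g k))
    {C : ℝ} (hC : ∀ k x, ‖g k x‖ ≤ C) :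
    ∫ ω, g (N ω) (Z (N ω) ω) ∂P = ∫ ω, ∫ ω', g (N ω) (Z (N ω) ω') ∂P ∂P := by
  have hZm : Measurable (fun ω k => Z k ω) := measurable_pi_lambda _ hZ
  have hG : Measurable (fun p : ℕ × (ℕ → ℝ) => g p.1 (p.2 p.1)) :=
    measurable_from_prod_countable_right fun k => (hg k).comp (measurable_pi_apply k)
  have hmap := (indepFun_iff_map_prod_eq_prod_map_map hN.aemeasurable hZm.aemeasurable).1 hind
  have := Measure.isProbabilityMeasure_map (μ := P) hN.aemeasurable
  have := Measure.isProbabilityMeasure_map (μ := P) hZm.aemeasurable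
  have h1 : ∫ ω, g (N ω) (Z (N ω) ω) ∂P =
      ∫ p, g p.1 (p.2 p.1) ∂(P.map (fun ω => (N ω, fun k => Z k ω))) := by
    rw [integral_map (hN.prodMk hZm).aemeasurable hG.aestronglyMeasurable]
  have hint : Integrable (fun p : ℕ × (ℕ → ℝ) => g p.1 (p.2 p.1))
      ((P.map N).prod (P.map (fun ω k => Z k ω))) :=
    Integrable.of_bound hG.aestronglyMeasurable C (ae_of_all _ fun p => hC _ _)
  rw [h1, hmap, integral_prod _ hint,
    integral_map hN.aemeasurable (measurable_from_nat.stronglyMeasurable).aestronglyMeasurable]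
  refine integral_congr_ae (ae_of_all _ fun ω => ?_)
  exact integral_map hZm.aemeasurable
    ((hg _).comp (measurable_pi_apply _)).aestronglyMeasurable

/-- The probability of an event about a sequence taken at an independent random index is computed
by first integrating out the sequence. -/
lemma measure_randomIndex_of_indepFun {N : Ω → ℕ} {Z : ℕ → Ω → ℝ}
    (hN : Measurable N) (hZ : ∀ k, Measurable (Z k))
    (hind : IndepFun N (fun ω k => Z k ω) P) {A : ℕ → Set ℝ} (hA : ∀ k, MeasurableSet (A k)) :
    P {ω | Z (N ω) ω ∈ A (N ω)} = ∫⁻ ω, P {ω' | Z (N ω) ω' ∈ A (N ω)} ∂P := by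
  have hZm : Measurable (fun ω k => Z k ω) := measurable_pi_lambda _ hZ
  have hB : MeasurableSet {p : ℕ × (ℕ → ℝ) | p.2 p.1 ∈ A p.1} := by
    have : {p : ℕ × (ℕ → ℝ) | p.2 p.1 ∈ A p.1} =
        ⋃ k, {k} ×ˢ ((fun x : ℕ → ℝ => x k) ⁻¹' A k) := by
      ext ⟨k, x⟩
      simp
    rw [this]
    exact MeasurableSet.iUnion fun k =>
      (MeasurableSet.singleton k).prod (measurable_pi_apply k (hA k))
  have hmap := (indepFun_iff_map_prod_eq_prod_map_map hN.aemeasurable hZm.aemeasurable).1 hind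
  have := Measure.isProbabilityMeasure_map (μ := P) hZm.aemeasurable
  have h1 : P {ω | Z (N ω) ω ∈ A (N ω)} =
      P.map (fun ω => (N ω, fun k => Z k ω)) {p : ℕ × (ℕ → ℝ) | p.2 p.1 ∈ A p.1} := by
    rw [Measure.map_apply (hN.prodMk hZm) hB]
    rfl
  rw [h1, hmap, Measure.prod_apply hB, lintegral_map (measurable_measure_prodMk_left hB) hN]
  refine lintegral_congr fun ω => ?_
  rw [Measure.map_apply hZm (measurable_prodMk_left hB)]
  rfl

variable {N : ℕ → Ω → ℕ} {Z : ℕ → Ω → ℝ}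

/-- Characteristic function of a randomly indexed and randomly scaled sequence. -/
lemma charFun_randomIndex_mul (hN : ∀ n, Measurable (N n)) (hZ : ∀ k, Measurable (Z k))
    (hind : ∀ n, IndepFun (N n) (fun ω k => Z k ω) P) (a : ℕ → ℝ) (n : ℕ) (t : ℝ) :
    charFun (P.map (fun ω => a (N n ω) * Z (N n ω) ω)) t =
      ∫ ω, charFun (P.map (Z (N n ω))) (t * a (N n ω)) ∂P := by
  have hm : Measurable (fun ω => a (N n ω) * Z (N n ω) ω) :=
    (measurable_from_nat.comp (hN n)).mul (measurable_randomIndex (hN n) hZ)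
  rw [charFun_apply_real, integral_map hm.aemeasurable (by fun_prop)]
  have h := integral_randomIndex_of_indepFun (hN n) hZ (hind n)
    (g := fun k x => Complex.exp (t * ((a k * x : ℝ) : ℂ) * Complex.I)) (C := 1)
    (fun k => by fun_prop)
    (fun k x => by rw [← Complex.ofReal_mul, Complex.norm_exp_ofReal_mul_I])
  rw [h]
  refine integral_congr_ae (ae_of_all _ fun ω => ?_)
  simp only
  rw [charFun_apply_real, integral_map (hZ _).aemeasurable (by fun_prop)]
  simp [mul_assoc]

/-- If the random scales `n / N n` are bounded in probability, then the characteristic function of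
`√(n / N n) * Z (N n)` is asymptotically that of a normal scale mixture. -/
lemma tendsto_charFun_randomIndex_sub (hN : ∀ n, Measurable (N n)) (hZ : ∀ k, Measurable (Z k))
    (hind : ∀ n, IndepFun (N n) (fun ω k => Z k ω) P) (hNinf : TendstoInftyInProbability P N)
    (hnorm : TendstoInDistribution Z atTop (fun x : ℝ => x) (fun _ => P) (gaussianReal 0 1))
    (htight : ∀ ε : ENNReal, 0 < ε → ∃ K : ℝ, 0 < K ∧
      ∀ᶠ n : ℕ in atTop, P {ω | K ≤ (n : ℝ) / N n ω} < ε) (t : ℝ) :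
    Tendsto (fun n : ℕ => charFun (P.map (fun ω => √((n : ℝ) / N n ω) * Z (N n ω) ω)) t -
      ((∫ ω, Real.exp (-(t ^ 2 / 2 * ((n : ℝ) / N n ω))) ∂P : ℝ) : ℂ)) atTop (𝓝 0) := by
  rw [Metric.tendsto_atTop']
  intro ε hε
  -- Error budget: `ε / 4` off the bad events `K ≤ n / N n` and `N n ≤ m + 1`, and at most `2` on
  -- each, where each has probability below `ε / 8`; in total less than `3ε / 4`.
  obtain ⟨K, hK, hKn⟩ := htight (ENNReal.ofReal (ε / 8)) (by simpa using by positivity)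
  have hunif := hnorm.tendstoUniformlyOn_charFun
    (isCompact_Icc (a := -(|t| * √K)) (b := |t| * √K))
  rw [Metric.tendstoUniformlyOn_iff] at hunif
  obtain ⟨m, hm⟩ := eventually_atTop.1 (hunif (ε / 4) (by positivity))
  -- `m + 1` rather than `m`, since the level must be positive.
  have hNm := (hNinf (m + 1) (by positivity)).eventually_lt_const
    (show (0 : ENNReal) < ENNReal.ofReal (ε / 8) by simpa using by positivity)
  obtain ⟨n₀, hn₀⟩ := eventually_atTop.1 (hKn.and hNm)
  refine ⟨n₀, fun n hn => ?_⟩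
  obtain ⟨h1, h2⟩ := hn₀ n hn.le
  have hU : Measurable (fun ω => (n : ℝ) / N n ω) :=
    (measurable_from_nat (f := fun k : ℕ => (n : ℝ) / k)).comp (hN n)
  set A := {ω | K ≤ (n : ℝ) / N n ω} with hA
  set B := {ω | (N n ω : ℝ) ≤ m + 1} with hB
  have hAm : MeasurableSet A := measurableSet_le measurable_const hU
  have hBm : MeasurableSet B :=
    measurableSet_le (measurable_from_nat.comp (hN n)) measurable_const
  have hA' : P.real A < ε / 8 := by
    rw [measureReal_def]
    exact (ENNReal.lt_ofReal_iff_toReal_lt (measure_ne_top _ _)).1 h1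
  have hB' : P.real B < ε / 8 := by
    rw [measureReal_def]
    exact (ENNReal.lt_ofReal_iff_toReal_lt (measure_ne_top _ _)).1 h2
  have hφ1 : ∀ k s, ‖charFun (P.map (Z k)) s‖ ≤ 1 := fun k s => by
    have := Measure.isProbabilityMeasure_map (μ := P) (hZ k).aemeasurable
    exact norm_charFun_le_one s
  have he1 : ∀ ω, Real.exp (-(t ^ 2 / 2 * ((n : ℝ) / N n ω))) ≤ 1 := fun ω => by
    rw [Real.exp_le_one_iff]
    have : 0 ≤ t ^ 2 / 2 * ((n : ℝ) / N n ω) := by positivity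
    linarith
  have hint1 : Integrable
      (fun ω => charFun (P.map (Z (N n ω))) (t * √((n : ℝ) / N n ω))) P :=
    Integrable.of_bound ((measurable_from_nat (f := fun k : ℕ =>
      charFun (P.map (Z k)) (t * √((n : ℝ) / k)))).comp (hN n)).aestronglyMeasurable 1
      (ae_of_all _ fun ω => hφ1 _ _)
  have hint2 : Integrable (fun ω => Real.exp (-(t ^ 2 / 2 * ((n : ℝ) / N n ω)))) P :=
    Integrable.of_bound (Real.measurable_exp.comp (hU.const_mul _).neg).aestronglyMeasurable 1
      (ae_of_all _ fun ω => by rw [Real.norm_of_nonneg (Real.exp_nonneg _)]; exact he1 ω)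
  have hint3 : Integrable
      (fun ω => ((Real.exp (-(t ^ 2 / 2 * ((n : ℝ) / N n ω))) : ℝ) : ℂ)) P := hint2.ofReal
  rw [dist_zero_right, charFun_randomIndex_mul hN hZ hind (fun k => √((n : ℝ) / k)) n t,
    ← integral_complex_ofReal, ← integral_sub hint1 hint3]
  have hbound : ∀ ω, ‖charFun (P.map (Z (N n ω))) (t * √((n : ℝ) / N n ω)) -
      ((Real.exp (-(t ^ 2 / 2 * ((n : ℝ) / N n ω))) : ℝ) : ℂ)‖ ≤
      ε / 4 + A.indicator (fun _ => 2) ω + B.indicator (fun _ => 2) ω := by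
    intro ω
    have hA0 : (0 : ℝ) ≤ A.indicator (fun _ => 2) ω :=
      Set.indicator_nonneg (fun _ _ => by norm_num) _
    have hB0 : (0 : ℝ) ≤ B.indicator (fun _ => 2) ω :=
      Set.indicator_nonneg (fun _ _ => by norm_num) _
    by_cases hω : ω ∈ A ∨ ω ∈ B
    · have h2 : (2 : ℝ) ≤ A.indicator (fun _ => 2) ω + B.indicator (fun _ => 2) ω := by
        rcases hω with h | h
        · rw [Set.indicator_of_mem h]; linarith
        · rw [Set.indicator_of_mem h]; linarith
      refine (norm_sub_le _ _).trans ?_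
      rw [Complex.norm_real, Real.norm_of_nonneg (Real.exp_nonneg _)]
      linarith [hφ1 (N n ω) (t * √((n : ℝ) / N n ω)), he1 ω]
    · rw [not_or] at hω
      obtain ⟨hωA, hωB⟩ := hω
      have hlt : (n : ℝ) / N n ω < K := not_le.1 hωA
      have hgt : (m : ℝ) + 1 < N n ω := not_le.1 hωB
      have hkm : m ≤ N n ω := by
        have : (m : ℝ) ≤ N n ω := by linarith
        exact_mod_cast this
      have hmem : t * √((n : ℝ) / N n ω) ∈ Set.Icc (-(|t| * √K)) (|t| * √K) := by
        rw [Set.mem_Icc, ← abs_le, abs_mul, abs_of_nonneg (Real.sqrt_nonneg _)]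
        gcongr
      have h3 := hm _ hkm _ hmem
      rw [Measure.map_id', charFun_gaussianReal, dist_comm, dist_eq_norm] at h3
      have h4 : Complex.exp (((t * √((n : ℝ) / N n ω) : ℝ) : ℂ) * ((0 : ℝ) : ℂ) * Complex.I -
          (((1 : NNReal) : ℝ) : ℂ) * ((t * √((n : ℝ) / N n ω) : ℝ) : ℂ) ^ 2 / 2) =
          ((Real.exp (-(t ^ 2 / 2 * ((n : ℝ) / N n ω))) : ℝ) : ℂ) := by
        have h5 : (t * √((n : ℝ) / N n ω)) ^ 2 = t ^ 2 * ((n : ℝ) / N n ω) := by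
          rw [mul_pow, Real.sq_sqrt (by positivity)]
        rw [← Complex.ofReal_pow, h5]
        push_cast
        congr 1
        ring
      rw [h4] at h3
      linarith
  calc _ ≤ ∫ ω, (ε / 4 + A.indicator (fun _ => 2) ω + B.indicator (fun _ => 2) ω) ∂P :=
        norm_integral_le_of_norm_le (((integrable_const _).add
          ((integrable_const _).indicator hAm)).add ((integrable_const _).indicator hBm))
          (ae_of_all _ hbound)
    _ = ε / 4 + 2 * P.real A + 2 * P.real B := by
        rw [integral_add ((integrable_const _).add ((integrable_const _).indicator hAm))
          ((integrable_const _).indicator hBm),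
          integral_add (integrable_const _) ((integrable_const _).indicator hAm),
          integral_indicator_const _ hAm, integral_indicator_const _ hBm]
        simp [mul_comm]
    _ < ε := by linarith

/-- Convergence in distribution of `√(n / N n) * Z (N n)`, where `Z` is asymptotically normal,
forces the random scales `n / N n` to be bounded in probability. -/
lemma exists_eventually_measure_div_ge_lt {Ω' : Type*} [MeasurableSpace Ω'] {Q : Measure Ω'}
    [IsProbabilityMeasure Q] {Y : Ω' → ℝ}
    (hN : ∀ n, Measurable (N n)) (hZ : ∀ k, Measurable (Z k))
    (hind : ∀ n, IndepFun (N n) (fun ω k => Z k ω) P) (hNinf : TendstoInftyInProbability P N)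
    (hnorm : TendstoInDistribution Z atTop (fun x : ℝ => x) (fun _ => P) (gaussianReal 0 1))
    (hS : TendstoInDistribution (fun (n : ℕ) ω => √((n : ℝ) / N n ω) * Z (N n ω) ω) atTop Y
      (fun _ => P) Q) {ε : ENNReal} (hε : 0 < ε) :
    ∃ K : ℝ, 0 < K ∧ ∀ᶠ n : ℕ in atTop, P {ω | K ≤ (n : ℝ) / N n ω} < ε := by
  have hopen : IsOpen {x : ℝ | 1 < |x|} := isOpen_lt continuous_const continuous_abs
  have hpos : 0 < gaussianReal 0 1 ((fun x : ℝ => x) ⁻¹' {x : ℝ | 1 < |x|}) := by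
    have hvol : volume ≪ gaussianReal 0 1 := gaussianReal_absolutelyContinuous' 0 one_ne_zero
    rw [pos_iff_ne_zero]
    intro h0
    exact (hopen.measure_pos volume ⟨2, by norm_num⟩).ne' (hvol h0)
  -- `c` is a lower bound for `P (|Z k| > 1)`, uniform over `k ≥ m`.
  obtain ⟨c, hc0, hc1⟩ := exists_between hpos
  have hctop : c ≠ ⊤ := (hc1.trans_le le_top).ne
  obtain ⟨m, hm⟩ := eventually_atTop.1 (hnorm.eventually_lt_measure_preimage hopen hc1)
  have hε2 : 0 < ε / 2 := ENNReal.half_pos hε.ne'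
  -- The level is `c * (ε / 2)`, so that the factor `c` in `h3` cancels.
  obtain ⟨R, hR, hRn⟩ := (hS.continuous_comp continuous_abs).exists_eventually_measure_ge_lt
    (ENNReal.mul_pos hc0.ne' hε2.ne')
  refine ⟨R ^ 2, by positivity, ?_⟩
  filter_upwards [hRn, (hNinf (m + 1) (by positivity)).eventually_lt_const hε2] with n h1 h2
  -- Given `N n` with `n / N n ≥ R ^ 2` and `N n > m + 1`, the event `|Z (N n)| > 1` has conditional
  -- probability at least `c` and makes the product at least `R`; Markov's inequality integrates
  -- this.
  have h3 : c * P {ω | R ^ 2 ≤ (n : ℝ) / N n ω ∧ (m : ℝ) + 1 < N n ω} ≤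
      P {ω | R ≤ |√((n : ℝ) / N n ω) * Z (N n ω) ω|} := by
    have h4 := measure_randomIndex_of_indepFun (hN n) hZ (hind n)
      (A := fun k => {x | R ≤ |√((n : ℝ) / k) * x|})
      (fun k => measurableSet_le measurable_const (by fun_prop))
    simp only [Set.mem_ofPred_eq] at h4
    rw [h4]
    refine le_trans ?_ (mul_meas_ge_le_lintegral (Measurable.comp (measurable_from_nat
      (f := fun k : ℕ => P {ω' | R ≤ |√((n : ℝ) / k) * Z k ω'|})) (hN n)) c)
    gcongr with ω
    rintro ⟨h5, h6⟩
    have hkm : m ≤ N n ω := by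
      have : (m : ℝ) ≤ N n ω := by linarith
      exact_mod_cast this
    refine (hm _ hkm).le.trans (measure_mono fun ω' hω' => ?_)
    simp only [Set.mem_preimage, Set.mem_ofPred_eq] at hω' ⊢
    rw [abs_mul, abs_of_nonneg (Real.sqrt_nonneg _)]
    have h7 : R ≤ √((n : ℝ) / N n ω) := Real.le_sqrt_of_sq_le h5
    nlinarith
  have h4 : P {ω | R ^ 2 ≤ (n : ℝ) / N n ω ∧ (m : ℝ) + 1 < N n ω} < ε / 2 := by
    have h5 := h3.trans_lt h1
    exact lt_of_mul_lt_mul_left' h5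
  calc P {ω | R ^ 2 ≤ (n : ℝ) / N n ω}
      ≤ P ({ω | (N n ω : ℝ) ≤ m + 1} ∪
          {ω | R ^ 2 ≤ (n : ℝ) / N n ω ∧ (m : ℝ) + 1 < N n ω}) := by
        refine measure_mono fun ω hω => ?_
        rcases le_or_gt (N n ω : ℝ) (m + 1) with h | h
        · exact Or.inl h
        · exact Or.inr ⟨hω, h⟩
    _ ≤ _ := measure_union_le _ _
    _ < ε / 2 + ε / 2 := ENNReal.add_lt_add h2 h4
    _ = ε := ENNReal.add_halves ε

end RandomIndex

/-! ### Mittag-Leffler laws and their link with Linnik laws. -/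

section MittagLeffler

variable {M : Measure ℝ} [IsProbabilityMeasure M] {β : ℝ}

lemma IsMittagLefflerLaw.integrable_exp (hM : IsMittagLefflerLaw β M) {s : ℝ} (hs : 0 ≤ s) :
    Integrable (fun x => Real.exp (-(s * x))) M := by
  refine Integrable.of_bound (by fun_prop) 1 ?_
  filter_upwards [hM.ae_nonneg] with x hx
  rw [Real.norm_of_nonneg (Real.exp_nonneg _), Real.exp_le_one_iff]
  have := mul_nonneg hs hx
  linarith

/-- A Mittag-Leffler law has no atom at `0`. -/
lemma IsMittagLefflerLaw.ae_pos (hM : IsMittagLefflerLaw β M) (hβ : 0 < β) :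
    ∀ᵐ x ∂M, 0 < x := by
  have h1 : Tendsto (fun s : ℝ => 1 / (1 + s ^ β)) atTop (𝓝 0) :=
    tendsto_const_nhds.div_atTop (tendsto_atTop_add_const_left _ _ (tendsto_rpow_atTop hβ))
  -- For every `s ≥ 0` the Laplace transform at `s` dominates the mass at `0`; let `s → ∞`.
  have h2 : M.real {0} ≤ 0 := by
    refine ge_of_tendsto h1 ?_
    filter_upwards [eventually_ge_atTop 0] with s hs
    rw [← hM.laplace_eq s hs, ← integral_indicator_one (measurableSet_singleton 0)]
    refine integral_mono ((integrable_const 1).indicator (measurableSet_singleton 0))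
      (hM.integrable_exp hs) fun x => ?_
    rcases eq_or_ne x 0 with rfl | hx
    · simp
    · simpa [hx] using Real.exp_nonneg _
  have h3 : M {0} = 0 := by
    rw [← measureReal_eq_zero_iff]
    exact le_antisymm h2 measureReal_nonneg
  have h4 : ∀ᵐ x ∂M, x ≠ 0 := by
    rw [ae_iff]
    simpa using h3
  filter_upwards [hM.ae_nonneg, h4] with x hx hx'
  exact lt_of_le_of_ne hx (Ne.symm hx')

/-- The Laplace transform of twice a Mittag-Leffler variable at `t ^ 2 / 2` is the characteristic
function of the Linnik law at `t`. -/
lemma IsMittagLefflerLaw.integral_exp_two_mul {α : ℝ} (hM : IsMittagLefflerLaw (α / 2) M)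
    (t : ℝ) : ∫ x, Real.exp (-(t ^ 2 / 2 * (2 * x))) ∂M = 1 / (1 + |t| ^ α) := by
  have h1 : (t ^ 2) ^ (α / 2) = |t| ^ α := by
    rw [← sq_abs, ← Real.rpow_natCast, ← Real.rpow_mul (abs_nonneg t)]
    congr 1
    push_cast
    ring
  rw [← h1, ← hM.laplace_eq (t ^ 2) (sq_nonneg t)]
  congr 1 with x
  ring_nf

end MittagLeffler

/-! ### The two implications for normal scale mixtures. -/

section NormalMixture

variable {Ω : Type*} [MeasurableSpace Ω] {P : Measure Ω} [IsProbabilityMeasure P]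
  {N : ℕ → Ω → ℕ} {Z : ℕ → Ω → ℝ} {α : ℝ} {L M : Measure ℝ} [IsProbabilityMeasure L]
  [IsProbabilityMeasure M]

/-- Convergence of the product makes `n / N n` tight, so its Laplace transforms converge to those of
`2M`. The moments of `exp (-n / N n)` then converge, and `y ↦ (-log y)⁻¹` recovers `N n / n`. -/
lemma tendstoInDistribution_div_of_linnik (hα0 : 0 < α) (hN : ∀ n, Measurable (N n))
    (hZ : ∀ k, Measurable (Z k)) (hind : ∀ n, IndepFun (N n) (fun ω k => Z k ω) P)
    (hNinf : TendstoInftyInProbability P N)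
    (hnorm : TendstoInDistribution Z atTop (fun x : ℝ => x) (fun _ => P) (gaussianReal 0 1))
    (hL : IsLinnikLaw α L) (hM : IsMittagLefflerLaw (α / 2) M)
    (hS : TendstoInDistribution (fun (n : ℕ) ω => √((n : ℝ) / N n ω) * Z (N n ω) ω) atTop
      (fun x : ℝ => x) (fun _ => P) L) :
    TendstoInDistribution (fun (n : ℕ) (ω : Ω) => (N n ω : ℝ) / (n : ℝ)) atTop
      (fun x : ℝ => (2 * x)⁻¹) (fun _ => P) M := by
  have hU (n : ℕ) : Measurable (fun ω => (n : ℝ) / N n ω) :=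
    (measurable_from_nat (f := fun k : ℕ => (n : ℝ) / k)).comp (hN n)
  have hmix (t : ℝ) : Tendsto (fun n : ℕ => ∫ ω, Real.exp (-(t ^ 2 / 2 * ((n : ℝ) / N n ω))) ∂P)
      atTop (𝓝 (1 / (1 + |t| ^ α))) := by
    have h1 := tendsto_charFun_randomIndex_sub hN hZ hind hNinf hnorm
      (fun ε hε => exists_eventually_measure_div_ge_lt hN hZ hind hNinf hnorm hS hε) t
    have h2 := ProbabilityMeasure.tendsto_iff_tendsto_charFun.1 hS.tendsto t
    simp only [ProbabilityMeasure.coe_mk, Measure.map_id', hL.charFun_eq t] at h2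
    have h3 := h2.sub h1
    simp only [sub_sub_cancel, sub_zero] at h3
    simpa only [Complex.ofReal_re, Function.comp_def] using
      (Complex.continuous_re.tendsto _).comp h3
  have hexp : TendstoInDistribution (fun (n : ℕ) ω => Real.exp (-((n : ℝ) / N n ω))) atTop
      (fun x : ℝ => Real.exp (-(2 * x))) (fun _ => P) M := by
    refine tendstoInDistribution_of_tendsto_moments
      (fun n => Real.measurable_exp.comp (hU n).neg) (by fun_prop)
      (fun n ω => ⟨Real.exp_nonneg _, Real.exp_le_one_iff.2 (neg_nonpos.2 (by positivity))⟩) ?_ ?_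
    · filter_upwards [hM.ae_nonneg] with x hx
      exact ⟨Real.exp_nonneg _, Real.exp_le_one_iff.2 (neg_nonpos.2 (by positivity))⟩
    · intro j
      -- At `t = √(2j)` the mixture integral is the `j`-th moment of `exp (-n / N n)`.
      have ht : √(2 * (j : ℝ)) ^ 2 / 2 = j := by
        rw [Real.sq_sqrt (by positivity)]
        ring
      have h1 := hmix √(2 * (j : ℝ))
      rw [← hM.integral_exp_two_mul, ht] at h1
      simpa only [← Real.exp_nat_mul, mul_neg] using h1
  -- The map is discontinuous at `y = 1`, which corresponds to `x = 0`; this is a null set because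
  -- `M` has no atom there.
  have hlog := hexp.comp_of_ae_continuousAt (g := fun y => (-Real.log y)⁻¹) (by fun_prop) (by
    filter_upwards [hM.ae_pos (by positivity)] with x hx
    refine ContinuousAt.inv₀ (Real.continuousAt_log (Real.exp_pos _).ne').neg ?_
    rw [Real.log_exp, neg_neg]
    positivity)
  simpa only [Real.log_exp, neg_neg, inv_div] using hlog

/-- Inversion is continuous away from `0`, so `n / N n` converges in law to `2M` and is therefore
tight; Lévy's continuity theorem applied to the mixture concludes. -/
lemma tendstoInDistribution_linnik_of_div (hα0 : 0 < α) (hN : ∀ n, Measurable (N n))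
    (hZ : ∀ k, Measurable (Z k)) (hind : ∀ n, IndepFun (N n) (fun ω k => Z k ω) P)
    (hNinf : TendstoInftyInProbability P N)
    (hnorm : TendstoInDistribution Z atTop (fun x : ℝ => x) (fun _ => P) (gaussianReal 0 1))
    (hL : IsLinnikLaw α L) (hM : IsMittagLefflerLaw (α / 2) M)
    (hW : TendstoInDistribution (fun (n : ℕ) (ω : Ω) => (N n ω : ℝ) / (n : ℝ)) atTop
      (fun x : ℝ => (2 * x)⁻¹) (fun _ => P) M) :
    TendstoInDistribution (fun (n : ℕ) ω => √((n : ℝ) / N n ω) * Z (N n ω) ω) atTop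
      (fun x : ℝ => x) (fun _ => P) L := by
  have hUlim := hW.comp_of_ae_continuousAt (g := fun y => y⁻¹) (by fun_prop) (by
    filter_upwards [hM.ae_pos (by positivity)] with x hx
    exact continuousAt_inv₀ (by positivity))
  simp only [inv_div, inv_inv] at hUlim
  have hSm (n : ℕ) : AEMeasurable (fun ω => √((n : ℝ) / N n ω) * Z (N n ω) ω) P :=
    (((measurable_from_nat (f := fun k : ℕ => √((n : ℝ) / k))).comp (hN n)).mul
      (measurable_randomIndex (hN n) hZ)).aemeasurable
  refine ⟨hSm, aemeasurable_id', ProbabilityMeasure.tendsto_iff_tendsto_charFun.2 fun t => ?_⟩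
  simp only [ProbabilityMeasure.coe_mk, Measure.map_id', hL.charFun_eq t]
  -- The absolute value makes the test function bounded on all of `ℝ`; it changes nothing on the
  -- nonnegative variables involved.
  have h1 := hUlim.tendsto_integral_comp (f := fun u => Real.exp (-(t ^ 2 / 2 * |u|)))
    (by fun_prop) (C := 1) (fun u => by
      rw [abs_of_nonneg (Real.exp_nonneg _)]
      exact Real.exp_le_one_iff.2 (neg_nonpos.2 (by positivity)))
  have h2 : ∫ x, Real.exp (-(t ^ 2 / 2 * |2 * x|)) ∂M = 1 / (1 + |t| ^ α) := by
    rw [← hM.integral_exp_two_mul]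
    refine integral_congr_ae ?_
    filter_upwards [hM.ae_nonneg] with x hx
    rw [abs_of_nonneg (by positivity : 0 ≤ 2 * x)]
  rw [h2] at h1
  have h3 (n : ℕ) (ω : Ω) : |(n : ℝ) / N n ω| = (n : ℝ) / N n ω := abs_of_nonneg (by positivity)
  simp only [h3] at h1
  have h4 := (tendsto_charFun_randomIndex_sub hN hZ hind hNinf hnorm
    (fun ε hε => hUlim.exists_eventually_measure_ge_lt hε) t).add
    ((Complex.continuous_ofReal.tendsto _).comp h1)
  simpa only [Function.comp_def, sub_add_cancel, zero_add] using h4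

end NormalMixture

/-! ### Reduction to the normalised statistics. -/

theorem theorem5 {Ω : Type*} [MeasurableSpace Ω] (P : Measure Ω) [IsProbabilityMeasure P]
    (α : ℝ) (hα0 : 0 < α) (hα2 : α ≤ 2)
    (X : ℕ → Ω → ℝ) (hX : ∀ i, Measurable (X i))
    (N : ℕ → Ω → ℕ) (hN : ∀ n, Measurable (N n)) (hNpos : ∀ n ω, 1 ≤ N n ω)
    (hNX : ∀ n, IndepFun (N n) (fun ω i => X i ω) P)
    (hNinf : TendstoInftyInProbability P N)
    (T : (n : ℕ) → (Fin n → ℝ) → ℝ) (hT : ∀ n, Measurable (T n))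
    (δ θ : ℝ) (hδ : 0 < δ) (hTnorm : AsymptoticallyNormal P T X δ θ)
    (L : Measure ℝ) [IsProbabilityMeasure L] (hL : IsLinnikLaw α L)
    (M : Measure ℝ) [IsProbabilityMeasure M] (hM : IsMittagLefflerLaw (α / 2) M) :
    TendstoInDistribution
        (fun (n : ℕ) (ω : Ω) => δ * √(n : ℝ) * (randomSizeStat T X (N n) ω - θ)) atTop
        (fun x : ℝ => x) (fun _ => P) L ↔
      TendstoInDistribution (fun (n : ℕ) (ω : Ω) => (N n ω : ℝ) / (n : ℝ)) atTop
        (fun x : ℝ => (2 * x)⁻¹) (fun _ => P) M := by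

  have hZ (k : ℕ) : Measurable (fun ω => δ * √(k : ℝ) * (sampleStat T X k ω - θ)) :=
    (((hT k).comp (measurable_pi_lambda _ fun i => hX i)).sub_const θ).const_mul _
  -- The whole sequence of normalised statistics is a measurable function of the sequence `X`, so it
  -- inherits independence from `N n`.
  have hind (n : ℕ) :
      IndepFun (N n) (fun ω (k : ℕ) => δ * √(k : ℝ) * (sampleStat T X k ω - θ)) P := by
    refine (hNX n).comp (φ := id)
      (ψ := fun (x : ℕ → ℝ) (k : ℕ) => δ * √(k : ℝ) * (T k (fun i => x i) - θ)) measurable_id ?_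
    refine measurable_pi_lambda _ fun k => (((hT k).comp ?_).sub_const θ).const_mul _
    exact measurable_pi_lambda _ fun i => measurable_pi_apply _
  have hscale : (fun (n : ℕ) (ω : Ω) => δ * √(n : ℝ) * (randomSizeStat T X (N n) ω - θ)) =
      fun (n : ℕ) ω => √((n : ℝ) / N n ω) * (δ * √(N n ω : ℝ) * (sampleStat T X (N n ω) ω - θ)) := by
    funext n ω
    -- `N n ≥ 1` is what allows `√(N n)` to cancel.
    have hpos : 0 < √(N n ω : ℝ) :=
      Real.sqrt_pos.2 (by exact_mod_cast hNpos n ω)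
    rw [Real.sqrt_div (Nat.cast_nonneg n), randomSizeStat]
    field_simp
  rw [hscale]
  exact ⟨tendstoInDistribution_div_of_linnik hα0 hN hZ hind hNinf hTnorm hL hM,
    tendstoInDistribution_linnik_of_div hα0 hN hZ hind hNinf hTnorm hL hM⟩
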